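/- Let $H$ be a separable complex Hilbert space, let $\mathcal A\subseteq\mathcal B(H)$ be a von Neumann algebra with commutant $\mathcal A'$, and let $\mathrm{Ad}(a)(x)=axa^*$ for $a,x\in\mathcal B(H)$. For a von Neumann algebra $\mathcal S\subseteq\mathcal B(H)$, let $\mathrm{CP}^\sigma_{\mathcal S}$ be the set of normal (that is, weak*-continuous) completely positive linear maps $\Phi:\mathcal B(H)\to\mathcal B(H)$ with $\Phi(axb)=a\Phi(x)b$ for all $a,b\in\mathcal S$ and $x\in\mathcal B(H)$, and let $\mathrm{UCP}^\sigma_{\mathcal S}$ be the set of those $\Phi\in\mathrm{CP}^\sigma_{\mathcal S}$ with $\Phi(1)=1$. A one-way right LOCC map relative to $\mathcal A$ is a normal unital completely positive map $\Theta:\mathcal B(H)\to\mathcal B(H)$ of the form $$\Theta(x)=\sum_{k=1}^\infty \Phi_k(\Psi_k(x)),\qquad x\in\mathcal B(H),\qquad (*)$$ where $\Phi_k\in\mathrm{UCP}^\sigma_{\mathcal A}$, $\Psi_k\in\mathrm{CP}^\sigma_{\mathcal A'}$, and the series converges in the weak* topology for every $x$. Let $\mathrm{LOCC}^r(\mathcal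 A)$ be the set of these maps. Then: (i) $\mathrm{LOCC}^r(\mathcal A)$ is closed under finite compositions. (ii) Every $\Theta\in\mathrm{LOCC}^r(\mathcal A)$ has a representation $(*)$ in which $\Psi_k=\mathrm{Ad}(a_k^*)$ with $a_k\in\mathcal A$ for all $k$, and $\sum_{k=1}^\infty a_k^*a_k=1$ in the weak* topology. (iii) In every representation $(*)$ of a map $\Theta\in\mathrm{LOCC}^r(\mathcal A)$, the maps $\Phi_k$ have the form $\Phi_k(x)=\sum_{i=1}^\infty \mathrm{Ad}(c_{ki}^*)(x)$, $x\in\mathcal B(H)$, a weak*-convergent series, for some $c_{ki}\in\mathcal A'$ with $\sum_{i=1}^\infty c_{ki}^*c_{ki}=1$ in the weak* topology for every $k$. In particular, the forms in (ii) and (iii) can be attained simultaneously. -/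

import Mathlib

namespace LOCC

/-- The algebra `B(H)` of bounded operators on `H`. -/
abbrev BOp (H : Type*) [NormedAddCommGroup H] [InnerProductSpace ℂ H] := H →L[ℂ] H

section
variable {H : Type*} [NormedAddCommGroup H] [InnerProductSpace ℂ H]

variable (H) in
/-- The weak* (ultraweak) topology of `B(H)`: the coarsest topology for which all the
functionals `T ↦ ∑ₙ ⟪ηₙ, T ξₙ⟫` with `∑ₙ ‖ξₙ‖² < ∞` and `∑ₙ ‖ηₙ‖² < ∞` are continuous.
These are the functionals `T ↦ tr (T S)` with `S = ∑ₙ ξₙ ηₙ^*` a trace class operator. -/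
@[reducible] noncomputable def weakStarTopology : TopologicalSpace (BOp H) :=
  ⨅ p : {p : (ℕ → H) × (ℕ → H) //
      Summable (fun n => ‖p.1 n‖ ^ 2) ∧ Summable (fun n => ‖p.2 n‖ ^ 2)},
    TopologicalSpace.induced (fun T : BOp H => ∑' n, inner ℂ (p.1.2 n) (T (p.1.1 n)))
      inferInstance

/-- The series `∑ₖ uₖ` converges to `T` in the weak* topology. -/
def WeakStarSum (u : ℕ → BOp H) (T : BOp H) : Prop :=
  Filter.Tendsto (fun n => ∑ k ∈ Finset.range n, u k) Filter.atTop
    (@nhds (BOp H) (weakStarTopology H) T)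

/-- A map on `B(H)` is normal if it is weak*-to-weak* continuous. -/
def IsNormal (Φ : BOp H →ₗ[ℂ] BOp H) : Prop :=
  @Continuous (BOp H) (BOp H) (weakStarTopology H) (weakStarTopology H) Φ

/-- `Φ (a x b) = a Φ(x) b` for all `a, b ∈ S` and `x ∈ B(H)`. -/
def IsBimoduleMap (S : Set (BOp H)) (Φ : BOp H →ₗ[ℂ] BOp H) : Prop :=
  ∀ a ∈ S, ∀ b ∈ S, ∀ x : BOp H, Φ (a * x * b) = a * Φ x * b

variable [CompleteSpace H]

/-- `Φ` is completely positive, in the sense of Mathlib's `CompletelyPositiveMap`. -/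
def IsCP (Φ : BOp H →ₗ[ℂ] BOp H) : Prop :=
  ∃ φ : CompletelyPositiveMap (BOp H) (BOp H), φ.toLinearMap = Φ

variable (H) in
/-- `CP^σ(B(H))`: the normal completely positive maps. -/
def NormalCP : Set (BOp H →ₗ[ℂ] BOp H) := {Φ | IsCP Φ ∧ IsNormal Φ}

variable (H) in
/-- `UCP^σ(B(H))`: the normal unital completely positive maps. -/
def NormalUCP : Set (BOp H →ₗ[ℂ] BOp H) := {Φ | Φ ∈ NormalCP H ∧ Φ 1 = 1}

/-- `CP^σ_S(B(H))`: the normal completely positive `S`-bimodule maps. -/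
def NormalCPBimod (S : VonNeumannAlgebra H) : Set (BOp H →ₗ[ℂ] BOp H) :=
  {Φ | Φ ∈ NormalCP H ∧ IsBimoduleMap (S : Set (BOp H)) Φ}

/-- `UCP^σ_S(B(H))`: the normal unital completely positive `S`-bimodule maps. -/
def NormalUCPBimod (S : VonNeumannAlgebra H) : Set (BOp H →ₗ[ℂ] BOp H) :=
  {Φ | Φ ∈ NormalCPBimod S ∧ Φ 1 = 1}

/-- The map `Ad(a) : x ↦ a x a^*`. -/
noncomputable def Ad (a : BOp H) : BOp H →ₗ[ℂ] BOp H where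
  toFun x := a * x * star a
  map_add' x y := by rw [mul_add, add_mul]
  map_smul' r x := by rw [mul_smul_comm, smul_mul_assoc, RingHom.id_apply]

/-- One-way right local maps relative to `A`. -/
def IsRightLocal (A : VonNeumannAlgebra H) (Θ : BOp H →ₗ[ℂ] BOp H) : Prop :=
  Θ ∈ NormalCP H ∧
    ∃ Φ ∈ NormalUCPBimod A, ∃ Ψ ∈ NormalCPBimod A.commutant, Θ = Φ.comp Ψ

/-- `I = (Θₖ)ₖ` is an instrument with `Θ_I = Θ`: every `Θₖ` is normal and completely positive,
`∑ₖ Θₖ(x)` converges weak* to `Θ(x)` for every `x`, and `Θ` is normal, unital and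
completely positive. -/
def IsInstrumentWithSum (I : ℕ → BOp H →ₗ[ℂ] BOp H) (Θ : BOp H →ₗ[ℂ] BOp H) : Prop :=
  (∀ k, I k ∈ NormalCP H) ∧ (∀ x, WeakStarSum (fun k => I k x) (Θ x)) ∧ Θ ∈ NormalUCP H

/-- `LOCC^r(A)`: the one-way right LOCC maps relative to `A`. -/
def LOCCr (A : VonNeumannAlgebra H) : Set (BOp H →ₗ[ℂ] BOp H) :=
  {Θ | ∃ I : ℕ → BOp H →ₗ[ℂ] BOp H, IsInstrumentWithSum I Θ ∧ ∀ k, IsRightLocal A (I k)}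

/-- `Θ = ∑ₖ Φₖ ∘ Ψₖ`, a point weak* convergent series, where `Φₖ ∈ UCP^σ_A(B(H))` and
`Ψₖ ∈ CP^σ_{A'}(B(H))`. -/
def IsRightDecomposition (A : VonNeumannAlgebra H) (Φ Ψ : ℕ → BOp H →ₗ[ℂ] BOp H)
    (Θ : BOp H →ₗ[ℂ] BOp H) : Prop :=
  (∀ k, Φ k ∈ NormalUCPBimod A) ∧ (∀ k, Ψ k ∈ NormalCPBimod A.commutant) ∧
    ∀ x, WeakStarSum (fun k => Φ k (Ψ k x)) (Θ x)

/-- `Φ = ∑ᵢ Ad(cᵢ^*)`, a point weak* convergent series, where all `cᵢ` lie in `S` and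
`∑ᵢ cᵢ^* cᵢ = 1` in the weak* topology. -/
def IsUnitalKraus (S : VonNeumannAlgebra H) (c : ℕ → BOp H) (Φ : BOp H →ₗ[ℂ] BOp H) : Prop :=
  (∀ i, c i ∈ S) ∧ WeakStarSum (fun i => star (c i) * c i) 1 ∧
    ∀ x, WeakStarSum (fun i => Ad (star (c i)) x) (Φ x)

end

end LOCC

/-!
The proof rests on Kraus decompositions. A normal completely positive map `Φ` on `B(H)`, with `H`
separable, has the form `Φ(x) = ∑ᵢ cᵢ^* x cᵢ` (`exists_kraus`), and if `Φ` is a bimodule map over a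
von Neumann algebra `S`, then all `cᵢ` lie in the commutant `S'`
(`mem_commutant_of_isBimoduleMap`).

The operators `cᵢ` come from the operator valued kernel `(ζ, ζ') ↦ Φ(|ζ⟩⟨ζ'|)` on the set `H`, which
is positive semidefinite because `Φ` is completely positive. The vectors of its reproducing kernel
Hilbert space are functions `H → H` which turn out to be bounded operators, and the `cᵢ` are the
adjoints of the members of a Hilbert basis. Parseval's identity for the kernel functions is the
Kraus decomposition on the rank one operators `|ζ⟩⟨ζ|`. Since `H` is separable, only countably many
`cᵢ` are nonzero. A positive operator `y^* y` is the sum of the rank one operators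
`|y^* eₙ⟩⟨y^* eₙ|`, so normality of `Φ` extends the decomposition to all of `B(H)`. For `a ∈ S` the
bimodule property gives `∑ᵢ (cᵢ a - a cᵢ)^* (cᵢ a - a cᵢ) = 0`, so that `cᵢ` commutes with `a`.

This yields the form of the maps `Φₖ ∈ UCP^σ_A(B(H))` at once. Applied to `Ψₖ ∈ CP^σ_{A'}(B(H))`,
it gives `aₖᵢ ∈ A'' = A` with `Θ = ∑ₖ ∑ᵢ Φₖ ∘ Ad(aₖᵢ^*)`, and evaluation at `1` gives
`∑ aₖᵢ^* aₖᵢ = 1`, as `Φₖ` fixes `A` pointwise. For a composite of two such maps, `Φ'ₗ` commutes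
with `Ad(aₖ^*)` for `aₖ ∈ A`, so `Φₖ ∘ Ad(aₖ^*) ∘ Φ'ₗ ∘ Ad(bₗ^*) = Φₖ ∘ Φ'ₗ ∘ Ad((bₗ aₖ)^*)`.

All rearrangements of series are justified by positivity: for positive operators, ultraweak
summability amounts to summability of the quadratic forms (`ultraweakHasSum_of_nonneg`), where
double series of nonnegative numbers can be reordered freely, and the positive operators span
`B(H)`.
-/

namespace LOCC

open scoped InnerProductSpace ComplexOrder
open Filter Topology

/-! ### Unconditional ultraweak sums -/

section Ultraweak

variable {H : Type*} [NormedAddCommGroup H] [InnerProductSpace ℂ H]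
variable {ι κ : Type*}

theorem tendsto_weakStar_iff {α : Type*} {l : Filter α} {f : α → BOp H} {T : BOp H} :
    Tendsto f l (@nhds (BOp H) (weakStarTopology H) T) ↔
      ∀ ξ η : ℕ → H, Summable (fun n => ‖ξ n‖ ^ 2) → Summable (fun n => ‖η n‖ ^ 2) →
        Tendsto (fun a => ∑' n, ⟪η n, f a (ξ n)⟫_ℂ) l (𝓝 (∑' n, ⟪η n, T (ξ n)⟫_ℂ)) := by
  unfold weakStarTopology
  rw [nhds_iInf, tendsto_iInf]
  simp only [nhds_induced, tendsto_comap_iff, Subtype.forall, Prod.forall, and_imp]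
  rfl

theorem summable_inner_apply {ξ η : ℕ → H} (hξ : Summable (fun n => ‖ξ n‖ ^ 2))
    (hη : Summable (fun n => ‖η n‖ ^ 2)) (T : BOp H) :
    Summable (fun n => ⟪η n, T (ξ n)⟫_ℂ) := by
  refine Summable.of_norm_bounded (g := fun n => ‖T‖ * (‖ξ n‖ ^ 2 + ‖η n‖ ^ 2))
    ((hξ.add hη).mul_left _) fun n => ?_
  have h1 := norm_inner_le_norm (𝕜 := ℂ) (η n) (T (ξ n))
  have h2 := T.le_opNorm (ξ n)
  have h3 : ‖η n‖ * ‖T (ξ n)‖ ≤ ‖η n‖ * (‖T‖ * ‖ξ n‖) := by gcongr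
  have h4 : ‖ξ n‖ * ‖η n‖ ≤ ‖ξ n‖ ^ 2 + ‖η n‖ ^ 2 := by
    nlinarith [sq_nonneg (‖ξ n‖ - ‖η n‖), sq_nonneg (‖ξ n‖), sq_nonneg (‖η n‖)]
  have h5 := mul_le_mul_of_nonneg_left h4 (norm_nonneg T)
  linarith

/-- The net of finite partial sums of `u` converges to `T` in the weak* topology. This is the
unconditional version of `WeakStarSum`, with an arbitrary index type. -/
def UltraweakHasSum (u : ι → BOp H) (T : BOp H) : Prop :=
  Tendsto (fun s : Finset ι => ∑ i ∈ s, u i) atTop (@nhds (BOp H) (weakStarTopology H) T)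

theorem ultraweakHasSum_iff {u : ι → BOp H} {T : BOp H} :
    UltraweakHasSum u T ↔
      ∀ ξ η : ℕ → H, Summable (fun n => ‖ξ n‖ ^ 2) → Summable (fun n => ‖η n‖ ^ 2) →
        HasSum (fun i => ∑' n, ⟪η n, u i (ξ n)⟫_ℂ) (∑' n, ⟪η n, T (ξ n)⟫_ℂ) := by
  unfold UltraweakHasSum
  rw [tendsto_weakStar_iff]
  refine forall₄_congr fun ξ η hξ hη => ?_
  have : (fun s : Finset ι => ∑' n, ⟪η n, (∑ i ∈ s, u i) (ξ n)⟫_ℂ) =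
      fun s => ∑ i ∈ s, ∑' n, ⟪η n, u i (ξ n)⟫_ℂ := by
    funext s
    rw [← Summable.tsum_finsetSum fun i _ => summable_inner_apply hξ hη (u i)]
    simp
  rw [this]
  rfl

theorem UltraweakHasSum.weakStarSum {u : ℕ → BOp H} {T : BOp H} (h : UltraweakHasSum u T) :
    WeakStarSum u T :=
  Tendsto.comp (f := Finset.range) (x := atTop) h tendsto_finset_range

theorem UltraweakHasSum.map {u : ι → BOp H} {T : BOp H} (h : UltraweakHasSum u T)
    {Φ : BOp H →ₗ[ℂ] BOp H} (hΦ : IsNormal Φ) : UltraweakHasSum (fun i => Φ (u i)) (Φ T) := by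
  have := Tendsto.comp ((@continuous_iff_continuousAt _ _ (weakStarTopology H)
    (weakStarTopology H) _).1 hΦ T) h
  simpa [UltraweakHasSum, Function.comp_def, map_sum] using this

theorem UltraweakHasSum.add {u v : ι → BOp H} {S T : BOp H} (hu : UltraweakHasSum u S)
    (hv : UltraweakHasSum v T) : UltraweakHasSum (fun i => u i + v i) (S + T) := by
  rw [ultraweakHasSum_iff] at *
  intro ξ η hξ hη
  have := (hu ξ η hξ hη).add (hv ξ η hξ hη)
  simpa [inner_add_right, Summable.tsum_add, summable_inner_apply hξ hη] using this

theorem UltraweakHasSum.smul {u : ι → BOp H} {T : BOp H} (hu : UltraweakHasSum u T) (r : ℂ) :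
    UltraweakHasSum (fun i => r • u i) (r • T) := by
  rw [ultraweakHasSum_iff] at *
  intro ξ η hξ hη
  simpa [inner_smul_right, tsum_mul_left] using (hu ξ η hξ hη).mul_left r

theorem ultraweakHasSum_zero : UltraweakHasSum (fun _ : ι => (0 : BOp H)) 0 := by
  rw [ultraweakHasSum_iff]
  intro ξ η _ _
  simp

theorem UltraweakHasSum.comp_equiv {u : ι → BOp H} {T : BOp H} (h : UltraweakHasSum u T)
    (e : κ ≃ ι) : UltraweakHasSum (fun k => u (e k)) T := by
  rw [ultraweakHasSum_iff] at *
  exact fun ξ η hξ hη => (e.hasSum_iff).2 (h ξ η hξ hη)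

/-- Sequences supported at `0` exhibit the vector functionals among those that define the weak*
topology. -/
theorem summable_single_sq {E : Type*} [NormedAddCommGroup E] (ξ : E) :
    Summable (fun n => ‖(Pi.single 0 ξ : ℕ → E) n‖ ^ 2) :=
  summable_of_ne_finset_zero (s := {0}) fun n hn => by
    have : n ≠ 0 := by simpa using hn
    simp [Pi.single_eq_of_ne this]

theorem tsum_inner_single (T : BOp H) (ξ η : H) :
    ∑' n, ⟪(Pi.single 0 η : ℕ → H) n, T ((Pi.single 0 ξ : ℕ → H) n)⟫_ℂ = ⟪η, T ξ⟫_ℂ := by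
  rw [tsum_eq_single 0 fun n hn => by simp [Pi.single_eq_of_ne hn]]
  simp

theorem UltraweakHasSum.inner {u : ι → BOp H} {T : BOp H} (h : UltraweakHasSum u T) (ξ η : H) :
    HasSum (fun i => ⟪η, u i ξ⟫_ℂ) ⟪η, T ξ⟫_ℂ := by
  simpa only [tsum_inner_single] using
    ultraweakHasSum_iff.1 h _ _ (summable_single_sq ξ) (summable_single_sq η)

theorem inner_apply_nonneg {T : BOp H} (hT : 0 ≤ T) (ξ : H) : 0 ≤ ⟪ξ, T ξ⟫_ℂ :=
  ((ContinuousLinearMap.nonneg_iff_isPositive T).1 hT).inner_nonneg_right ξ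

theorem hasSum_of_nonneg_of_tendsto {f : ℕ → ℂ} (hf : ∀ i, 0 ≤ f i) {s : ℂ}
    (h : Tendsto (fun n => ∑ i ∈ Finset.range n, f i) atTop (𝓝 s)) : HasSum f s := by
  have hre : ∀ i, f i = ((f i).re : ℂ) := fun i => Complex.eq_re_of_ofReal_le (hf i)
  have h1 : Tendsto (fun n => ∑ i ∈ Finset.range n, (f i).re) atTop (𝓝 s.re) := by
    simpa [Function.comp_def] using (Complex.continuous_re.tendsto s).comp h
  have h2 := (hasSum_iff_tendsto_nat_of_nonneg
    (fun i => (Complex.nonneg_iff.1 (hf i)).1) _).2 h1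
  have h3 : HasSum f (s.re : ℂ) := by
    have := Complex.hasSum_ofReal.2 h2
    simpa only [← hre] using this
  rwa [tendsto_nhds_unique h h3.tendsto_sum_nat]

theorem WeakStarSum.hasSum_inner {u : ℕ → BOp H} {T : BOp H} (hu : ∀ i, 0 ≤ u i)
    (h : WeakStarSum u T) (ξ : H) : HasSum (fun i => ⟪ξ, u i ξ⟫_ℂ) ⟪ξ, T ξ⟫_ℂ := by
  refine hasSum_of_nonneg_of_tendsto (fun i => inner_apply_nonneg (hu i) ξ) ?_
  have := tendsto_weakStar_iff.1 h _ _ (summable_single_sq ξ) (summable_single_sq ξ)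
  simp only [tsum_inner_single] at this
  simpa [inner_sum] using this

theorem hasSum_inner_of_hasSum_inner_self {u : ι → BOp H} {T : BOp H}
    (h : ∀ ξ, HasSum (fun i => ⟪ξ, u i ξ⟫_ℂ) ⟪ξ, T ξ⟫_ℂ) (ξ η : H) :
    HasSum (fun i => ⟪η, u i ξ⟫_ℂ) ⟪η, T ξ⟫_ℂ := by
  -- polarization
  have key : ∀ S : BOp H, ⟪η, S ξ⟫_ℂ = (⟪η + ξ, S (η + ξ)⟫_ℂ - ⟪η - ξ, S (η - ξ)⟫_ℂ
      - Complex.I * ⟪η + Complex.I • ξ, S (η + Complex.I • ξ)⟫_ℂ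
      + Complex.I * ⟪η - Complex.I • ξ, S (η - Complex.I • ξ)⟫_ℂ) / 4 := by
    intro S
    simp only [map_add, map_sub, map_smul, inner_add_left, inner_add_right, inner_sub_left,
      inner_sub_right, inner_smul_left, inner_smul_right, Complex.conj_I]
    ring_nf
    simp only [Complex.I_sq]
    ring
  simp only [key]
  exact ((((h _).sub (h _)).sub ((h _).mul_left _)).add ((h _).mul_left _)).div_const _

/-- Tonelli's theorem for series of nonnegative complex numbers. -/
theorem hasSum_prod_of_nonneg {f : ι × κ → ℂ} (hf : ∀ p, 0 ≤ f p) {g : ι → ℂ} {s : ℂ}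
    (h : ∀ i, HasSum (fun j => f (i, j)) (g i)) (hg : HasSum g s) : HasSum f s := by
  have hn : ∀ p, f p = (‖f p‖ : ℂ) := fun p => Complex.eq_coe_norm_of_nonneg (hf p)
  have h1 : ∀ i, HasSum (fun j => ‖f (i, j)‖) ‖g i‖ := by
    intro i
    have h2 := (h i).summable.norm.hasSum
    have h3 : HasSum (fun j => f (i, j)) ((∑' j, ‖f (i, j)‖ : ℝ) : ℂ) := by
      have := Complex.hasSum_ofReal.2 h2
      simpa only [← hn] using this
    rw [(h i).unique h3, Complex.norm_real,
      Real.norm_of_nonneg (tsum_nonneg fun _ => norm_nonneg _)]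
    exact h2
  have h4 : Summable f := by
    refine Summable.of_norm ((summable_prod_of_nonneg fun _ => norm_nonneg _).2
      ⟨fun i => (h1 i).summable, ?_⟩)
    simpa only [(h1 _).tsum_eq] using hg.summable.norm
  have h5 := h4.hasSum.prod_fiberwise h
  rw [hg.unique h5]
  exact h4.hasSum

theorem hasSum_prod_fiberwise_snd {f : ι × κ → ℂ} {g : κ → ℂ} {s : ℂ} (hf : HasSum f s)
    (h : ∀ j, HasSum (fun i => f (i, j)) (g j)) : HasSum g s :=
  ((Equiv.prodComm κ ι).hasSum_iff.2 hf).prod_fiberwise h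

variable [CompleteSpace H]

/-- Cauchy–Schwarz for the form of a positive operator, in its arithmetic mean version. -/
theorem norm_inner_apply_le_of_nonneg {T : BOp H} (hT : 0 ≤ T) (ξ η : H) :
    ‖⟪η, T ξ⟫_ℂ‖ ≤ ‖⟪ξ, T ξ⟫_ℂ‖ + ‖⟪η, T η⟫_ℂ‖ := by
  obtain ⟨y, rfl⟩ := CStarAlgebra.nonneg_iff_eq_star_mul_self.1 hT
  have key : ∀ a b : H, ⟪a, (star y * y) b⟫_ℂ = ⟪y a, y b⟫_ℂ := fun a b => by
    simp [ContinuousLinearMap.star_eq_adjoint, ContinuousLinearMap.adjoint_inner_right]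
  simp only [key, inner_self_eq_norm_sq_to_K, norm_pow]
  have := norm_inner_le_norm (𝕜 := ℂ) (y η) (y ξ)
  simp only [Complex.coe_algebraMap, Complex.norm_real, norm_norm]
  nlinarith [sq_nonneg (‖y η‖ - ‖y ξ‖), sq_nonneg (‖y η‖), sq_nonneg (‖y ξ‖)]

/-- For positive operators, ultraweak summability can be tested on quadratic forms: the mixed
terms are dominated by the diagonal ones, which allows the two summations to be exchanged. -/
theorem ultraweakHasSum_of_nonneg {u : ι → BOp H} {T : BOp H} (hu : ∀ i, 0 ≤ u i)
    (h : ∀ ξ, HasSum (fun i => ⟪ξ, u i ξ⟫_ℂ) ⟪ξ, T ξ⟫_ℂ) : UltraweakHasSum u T := by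
  rw [ultraweakHasSum_iff]
  intro ξ η hξ hη
  have diag : ∀ ζ : ℕ → H, Summable (fun n => ‖ζ n‖ ^ 2) →
      Summable (fun p : ℕ × ι => ⟪ζ p.1, u p.2 (ζ p.1)⟫_ℂ) := fun ζ hζ =>
    (hasSum_prod_of_nonneg (fun p => inner_apply_nonneg (hu p.2) _) (fun n => h (ζ n))
      (summable_inner_apply hζ hζ T).hasSum).summable
  have hF : Summable (fun p : ℕ × ι => ⟪η p.1, u p.2 (ξ p.1)⟫_ℂ) :=
    Summable.of_norm_bounded ((diag ξ hξ).norm.add (diag η hη).norm)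
      fun p => norm_inner_apply_le_of_nonneg (hu p.2) _ _
  have h1 := hF.hasSum.prod_fiberwise fun n => hasSum_inner_of_hasSum_inner_self h (ξ n) (η n)
  rw [h1.tsum_eq]
  exact hasSum_prod_fiberwise_snd hF.hasSum fun i => (summable_inner_apply hξ hη (u i)).hasSum

end Ultraweak

section CompletelyPositive

universe u

variable {H : Type u} [NormedAddCommGroup H] [InnerProductSpace ℂ H] [CompleteSpace H]
variable {ι κ : Type*}

/-! ### Completely positive maps -/

theorem IsCP.map_nonneg {Φ : BOp H →ₗ[ℂ] BOp H} (h : IsCP Φ) {x : BOp H} (hx : 0 ≤ x) :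
    0 ≤ Φ x := by
  obtain ⟨φ, rfl⟩ := h
  exact _root_.map_nonneg φ hx

theorem IsCP.comp {Φ Ψ : BOp H →ₗ[ℂ] BOp H} (hΦ : IsCP Φ) (hΨ : IsCP Ψ) :
    IsCP (Φ.comp Ψ) := by
  obtain ⟨φ, rfl⟩ := hΦ
  obtain ⟨ψ, rfl⟩ := hΨ
  exact ⟨⟨φ.toLinearMap.comp ψ.toLinearMap, fun k M hM =>
    φ.map_cstarMatrix_nonneg' k _ (ψ.map_cstarMatrix_nonneg' k M hM)⟩, rfl⟩

/-- A form of `CStarAlgebra.nonneg_iff_eq_star_mul_self` whose instance arguments can be found for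
`CStarMatrix`. -/
theorem exists_eq_star_mul_self_of_nonneg {B : Type*} [NonUnitalCStarAlgebra B] [PartialOrder B]
    [StarOrderedRing B] {b : B} (hb : 0 ≤ b) : ∃ y, b = star y * y :=
  CStarAlgebra.nonneg_iff_eq_star_mul_self.1 hb

theorem isCP_Ad (a : BOp H) : IsCP (Ad a) := by
  refine ⟨⟨Ad a, fun k M hM => ?_⟩, rfl⟩
  obtain ⟨Y, rfl⟩ := exists_eq_star_mul_self_of_nonneg hM
  have : (star Y * Y).map (Ad a) =
      star (Y.map fun y => y * star a) * (Y.map fun y => y * star a) := by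
    ext1 i j
    simp [CStarMatrix.mul_apply, CStarMatrix.star_apply, CStarMatrix.map_apply, Ad, Finset.mul_sum,
      Finset.sum_mul, mul_assoc]
  rw [this]
  exact star_mul_self_nonneg _

theorem IsCP.map_star {Φ : BOp H →ₗ[ℂ] BOp H} (h : IsCP Φ) (x : BOp H) :
    Φ (star x) = star (Φ x) := by
  obtain ⟨φ, rfl⟩ := h
  exact StarHomClass.map_star (PositiveLinearMap.ofClass φ : BOp H →ₚ[ℂ] BOp H) x

theorem IsCP.exists_norm_apply_le {Φ : BOp H →ₗ[ℂ] BOp H} (h : IsCP Φ) :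
    ∃ C : NNReal, ∀ x, ‖Φ x‖ ≤ C * ‖x‖ := by
  obtain ⟨φ, rfl⟩ := h
  exact PositiveLinearMap.exists_norm_apply_le (PositiveLinearMap.ofClass φ : BOp H →ₚ[ℂ] BOp H)

open InnerProductSpace in
/-- The matrix `(|ζᵢ⟩⟨ζⱼ|)` is positive: it is `R^* R`, where each row of `R` consists of the
operators `|e⟩⟨ζⱼ|` for a suitable multiple `e` of a unit vector. -/
theorem rankOne_matrix_nonneg {n : Type*} [Fintype n] (ζ : n → H) :
    0 ≤ (CStarMatrix.ofMatrix fun i j => rankOne ℂ (ζ i) (ζ j) : CStarMatrix n n (BOp H)) := by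
  cases isEmpty_or_nonempty n
  · exact le_of_eq (by ext1 i; exact isEmptyElim i)
  cases subsingleton_or_nontrivial H
  · refine le_of_eq (by ext1 i j; exact Subsingleton.elim _ _)
  obtain ⟨e, he⟩ := NormedSpace.exists_lt_norm ℂ H 0
  -- normalized so that the `card n` equal rows of `R` add up to the given matrix
  obtain ⟨e, he⟩ : ∃ e : H, (Fintype.card n : ℂ) * ⟪e, e⟫_ℂ = 1 := by
    refine ⟨(((Real.sqrt (Fintype.card n))⁻¹ * ‖e‖⁻¹ : ℝ) : ℂ) • e, ?_⟩
    have h1 : (Real.sqrt (Fintype.card n)) ^ 2 = Fintype.card n := Real.sq_sqrt (by positivity)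
    rw [inner_self_eq_norm_sq_to_K, norm_smul]
    simp only [norm_inv, norm_mul, Complex.norm_real, Real.norm_eq_abs, abs_norm,
      Real.sqrt_nonneg, abs_of_nonneg]
    rw [inv_mul_cancel_right₀ he.ne', ← RCLike.ofReal_pow, inv_pow, h1]
    simp
  have : (CStarMatrix.ofMatrix fun i j => rankOne ℂ (ζ i) (ζ j) : CStarMatrix n n (BOp H)) =
      star (CStarMatrix.ofMatrix fun _ j => rankOne ℂ e (ζ j) : CStarMatrix n n (BOp H)) *
        (CStarMatrix.ofMatrix fun _ j => rankOne ℂ e (ζ j) : CStarMatrix n n (BOp H)) := by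
    ext1 i j
    have h1 : star (rankOne ℂ e (ζ i)) * rankOne ℂ e (ζ j) =
        ⟪e, e⟫_ℂ • rankOne ℂ (ζ i) (ζ j) := by
      rw [ContinuousLinearMap.star_eq_adjoint, adjoint_rankOne, ContinuousLinearMap.mul_def,
        rankOne_comp_rankOne]
    change rankOne ℂ (ζ i) (ζ j) = ∑ _ : n, star (rankOne ℂ e (ζ i)) * rankOne ℂ e (ζ j)
    rw [h1, Finset.sum_const, Finset.card_univ]
    rw [← Nat.cast_smul_eq_nsmul ℂ, smul_smul, he, one_smul]
  rw [this]
  exact star_mul_self_nonneg _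

/-- A positive matrix of operators has a positive quadratic form on vectors of vectors. -/
theorem sum_inner_nonneg_of_nonneg {n : Type*} [Fintype n] {N : CStarMatrix n n (BOp H)}
    (hN : 0 ≤ N) (ξ : n → H) : 0 ≤ ∑ i, ∑ j, ⟪ξ i, N i j (ξ j)⟫_ℂ := by
  obtain ⟨Y, rfl⟩ := exists_eq_star_mul_self_of_nonneg hN
  have : ∑ i, ∑ j, ⟪ξ i, (star Y * Y) i j (ξ j)⟫_ℂ =
      ∑ l, ⟪∑ i, Y l i (ξ i), ∑ j, Y l j (ξ j)⟫_ℂ := by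
    simp only [CStarMatrix.mul_apply, CStarMatrix.star_apply, sum_apply, inner_sum, sum_inner,
      mul_apply_eq_comp, ContinuousLinearMap.star_eq_adjoint,
      ContinuousLinearMap.adjoint_inner_right]
    rw [Finset.sum_comm_cycle]
    exact Finset.sum_congr rfl fun l _ => Finset.sum_comm
  rw [this]
  refine Finset.sum_nonneg fun l _ => ?_
  rw [inner_self_eq_norm_sq_to_K]
  positivity

/-! ### The reproducing kernel Hilbert space of a completely positive map -/

/-- The operator valued kernel `(ζ, ζ') ↦ Φ(|ζ⟩⟨ζ'|)` on the set `H`. -/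
noncomputable def kernelMatrix (Φ : BOp H →ₗ[ℂ] BOp H) : Matrix H H (H →L[ℂ] H) :=
  .of fun ζ ζ' => Φ (InnerProductSpace.rankOne ℂ ζ ζ')

theorem IsCP.posSemidef_kernelMatrix {Φ : BOp H →ₗ[ℂ] BOp H} (h : IsCP Φ) :
    (kernelMatrix Φ).PosSemidef := by
  have key := (RKHS.posSemidef_tfae (K := kernelMatrix Φ)).out 0 2
  refine key.2 ⟨?_, fun v => ?_⟩
  · ext1 ζ ζ'
    simp [kernelMatrix, Matrix.conjTranspose_apply, ← h.map_star,
      ContinuousLinearMap.star_eq_adjoint]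
  · obtain ⟨φ, rfl⟩ := h
    have := sum_inner_nonneg_of_nonneg (φ.map_cstarMatrix_nonneg _
      (rankOne_matrix_nonneg (fun i : v.support => (i : H)))) (fun i => v i)
    have e : ∑ i : v.support, ∑ j : v.support,
        ⟪v i, φ (InnerProductSpace.rankOne ℂ (i : H) j) (v j)⟫_ℂ =
        ∑ ζ' ∈ v.support, ∑ ζ ∈ v.support,
          ⟪v ζ', kernelMatrix φ.toLinearMap ζ' ζ (v ζ)⟫_ℂ := by
      refine Eq.trans ?_ (Finset.sum_coe_sort v.support fun ζ' => ∑ ζ ∈ v.support,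
        ⟪v ζ', kernelMatrix φ.toLinearMap ζ' ζ (v ζ)⟫_ℂ)
      refine Finset.sum_congr rfl fun i _ => ?_
      exact Finset.sum_coe_sort v.support
        fun ζ => ⟪v i, kernelMatrix φ.toLinearMap i ζ (v ζ)⟫_ℂ
    replace this := (Complex.nonneg_iff.1 (this.trans_eq e)).1
    rw [Finset.sum_comm] at this
    simp only [Complex.re_sum] at this
    simp only [Finsupp.sum, RCLike.re_eq_complex_re, Complex.re_sum]
    refine this.trans_eq ?_
    refine Finset.sum_congr rfl fun ζ _ => Finset.sum_congr rfl fun ζ' _ => ?_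
    exact inner_re_symm (𝕜 := ℂ) _ _

/-- A vector of the reproducing kernel Hilbert space of `Φ` is a function `H → H`. This function
is linear because the kernel function at `ζ` is conjugate linear in `ζ`, and bounded because its
norm at `ζ` is at most `‖f‖ ‖Φ(|ζ⟩⟨ζ|)‖^{1/2}`. -/
theorem IsCP.exists_clm_eq {Φ : BOp H →ₗ[ℂ] BOp H} (h : IsCP Φ)
    [Fact (kernelMatrix Φ).PosSemidef] (f : RKHS.OfKernel (kernelMatrix Φ)) :
    ∃ D : BOp H, ∀ ζ, D ζ = f ζ := by
  obtain ⟨C, hC⟩ := h.exists_norm_apply_le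
  have hker : ∀ ζ ζ' ξ, RKHS.kerFun (RKHS.OfKernel (kernelMatrix Φ)) ζ' ξ ζ =
      Φ (InnerProductSpace.rankOne ℂ ζ ζ') ξ := fun ζ ζ' ξ => by
    rw [RKHS.kerFun_apply, RKHS.OfKernel.kernel_ofKernel]
    rfl
  let D : H →ₗ[ℂ] H :=
    { toFun := fun ζ => f ζ
      map_add' := fun ζ ζ' => by
        refine ext_inner_left ℂ fun ξ => ?_
        have : RKHS.kerFun (RKHS.OfKernel (kernelMatrix Φ)) (ζ + ζ') ξ =
            RKHS.kerFun _ ζ ξ + RKHS.kerFun _ ζ' ξ := by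
          ext x
          simp [hker]
        rw [← RKHS.kerFun_inner, this, inner_add_left, inner_add_right, RKHS.kerFun_inner,
          RKHS.kerFun_inner]
      map_smul' := fun r ζ => by
        refine ext_inner_left ℂ fun ξ => ?_
        have : RKHS.kerFun (RKHS.OfKernel (kernelMatrix Φ)) (r • ζ) ξ =
            (starRingEnd ℂ r) • RKHS.kerFun _ ζ ξ := by
          ext x
          simp [hker]
        rw [← RKHS.kerFun_inner, this, inner_smul_left, RKHS.kerFun_inner]
        simp [inner_smul_right] }
  refine ⟨D.mkContinuous (‖f‖ * √C) fun ζ => ?_, fun ζ => rfl⟩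
  refine (RKHS.norm_apply_le f ζ).trans ?_
  rw [RKHS.OfKernel.kernel_ofKernel, mul_assoc]
  gcongr
  refine Real.sqrt_le_iff.2 ⟨by positivity, ?_⟩
  rw [mul_pow, Real.sq_sqrt (NNReal.coe_nonneg C)]
  refine (hC _).trans_eq ?_
  rw [InnerProductSpace.norm_rankOne, sq]

theorem inner_star_mul_rankOne_mul (c : BOp H) (ζ ξ : H) :
    ⟪ξ, (star c * InnerProductSpace.rankOne ℂ ζ ζ * c) ξ⟫_ℂ =
      ⟪ξ, star c ζ⟫_ℂ * ⟪star c ζ, ξ⟫_ℂ := by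
  simp [ContinuousLinearMap.star_eq_adjoint, ContinuousLinearMap.adjoint_inner_left,
    mul_comm]

/-- Parseval's identity in the reproducing kernel Hilbert space of `Φ` gives the Kraus
decomposition on the rank one operators `|ζ⟩⟨ζ|`. -/
theorem IsCP.exists_kraus_rankOne {Φ : BOp H →ₗ[ℂ] BOp H} (h : IsCP Φ) :
    ∃ (ι : Type u) (c : ι → BOp H), ∀ ζ ξ,
      HasSum (fun i => ⟪ξ, (star (c i) * InnerProductSpace.rankOne ℂ ζ ζ * c i : BOp H) ξ⟫_ℂ)
        ⟪ξ, Φ (InnerProductSpace.rankOne ℂ ζ ζ) ξ⟫_ℂ := by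
  have : Fact (kernelMatrix Φ).PosSemidef := ⟨h.posSemidef_kernelMatrix⟩
  obtain ⟨w, b, -⟩ := exists_hilbertBasis ℂ (RKHS.OfKernel (kernelMatrix Φ))
  choose D hD using h.exists_clm_eq
  refine ⟨w, fun i => star (D (b i)), fun ζ ξ => ?_⟩
  have := b.hasSum_inner_mul_inner (RKHS.kerFun _ ζ ξ) (RKHS.kerFun _ ζ ξ)
  have e1 : ∀ f : RKHS.OfKernel (kernelMatrix Φ),
      ⟪ξ, (star (star (D f)) * InnerProductSpace.rankOne ℂ ζ ζ * star (D f)) ξ⟫_ℂ =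
        ⟪RKHS.kerFun (RKHS.OfKernel (kernelMatrix Φ)) ζ ξ, f⟫_ℂ *
          ⟪f, RKHS.kerFun (RKHS.OfKernel (kernelMatrix Φ)) ζ ξ⟫_ℂ := fun f => by
    rw [RKHS.kerFun_inner, RKHS.inner_kerFun, inner_star_mul_rankOne_mul, star_star, hD]
  have e2 : ⟪ξ, Φ (InnerProductSpace.rankOne ℂ ζ ζ) ξ⟫_ℂ =
      ⟪RKHS.kerFun (RKHS.OfKernel (kernelMatrix Φ)) ζ ξ,
        RKHS.kerFun (RKHS.OfKernel (kernelMatrix Φ)) ζ ξ⟫_ℂ := by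
    rw [RKHS.kerFun_inner, RKHS.kerFun_apply, RKHS.OfKernel.kernel_ofKernel]
    rfl
  simp only [e1, e2]
  exact this

/-- A family with countably many nonzero members can be replaced by a sequence, as far as sums of
functions vanishing at `0` are concerned. -/
theorem exists_nat_reindex {X : Type*} [Zero X] {c : ι → X} (hc : {i | c i ≠ 0}.Countable) :
    ∃ d : ℕ → X, ∀ F : X → ℂ, F 0 = 0 → ∀ s, HasSum (fun i => F (c i)) s →
      HasSum (fun n => F (d n)) s := by
  have := hc.to_subtype
  obtain ⟨g, hg⟩ := exists_injective_nat {i | c i ≠ 0}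
  refine ⟨Function.extend g (fun i => c i) 0, fun F hF s hs => ?_⟩
  have h1 : HasSum (fun i : {i | c i ≠ 0} => F (c i)) s :=
    (hasSum_subtype_iff_of_support_subset fun i hi => by
      intro h0
      exact hi (by simp [h0, hF])).2 hs
  refine (hg.hasSum_iff fun n hn => ?_).1 ?_
  · rw [Function.extend_apply' _ _ _ fun ⟨a, ha⟩ => hn ⟨a, ha⟩]
    exact hF
  · simpa [Function.comp_def, hg.extend_apply] using h1

/-- On a separable space, a family of operators for which all `∑ᵢ |⟨ζ, cᵢ ξ⟩|²` converge has at
most countably many nonzero members. -/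
theorem countable_ne_zero_of_summable [TopologicalSpace.SeparableSpace H] {c : ι → BOp H}
    (hc : ∀ ζ ξ, Summable
      fun i => ⟪ξ, (star (c i) * InnerProductSpace.rankOne ℂ ζ ζ * c i : BOp H) ξ⟫_ℂ) :
    {i | c i ≠ 0}.Countable := by
  obtain ⟨s, hs, hd⟩ := TopologicalSpace.exists_countable_dense H
  refine ((hs.biUnion fun ζ _ => hs.biUnion fun ξ _ =>
    (hc ζ ξ).countable_support)).mono fun i hi => ?_
  by_contra hcon
  simp only [Set.mem_iUnion, not_exists, Function.mem_support, not_not,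
    inner_star_mul_rankOne_mul] at hcon
  refine hi (ContinuousLinearMap.ext fun ξ => ?_)
  refine ext_inner_left ℂ fun ζ => ?_
  rw [zero_apply, inner_zero_right]
  have h1 : ∀ ζ ∈ s, ∀ ξ ∈ s, ⟪ζ, c i ξ⟫_ℂ = 0 := fun ζ hζ ξ hξ => by
    rcases mul_eq_zero.1 (hcon ζ hζ ξ hξ) with h0 | h0
    · rw [← ContinuousLinearMap.adjoint_inner_left, ← ContinuousLinearMap.star_eq_adjoint,
        ← inner_conj_symm, h0, map_zero]
    · rwa [← ContinuousLinearMap.adjoint_inner_left, ← ContinuousLinearMap.star_eq_adjoint]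
  have h2 : ∀ ζ ∈ s, ∀ ξ, ⟪ζ, c i ξ⟫_ℂ = 0 := fun ζ hζ =>
    fun ξ => congrFun (Continuous.ext_on hd (by fun_prop) continuous_const (h1 ζ hζ)) ξ
  exact congrFun (Continuous.ext_on hd (f := fun ζ => ⟪ζ, c i ξ⟫_ℂ) (by fun_prop)
    continuous_const fun ζ hζ => h2 ζ hζ ξ) ζ

end CompletelyPositive

section NormalMaps

variable {H : Type*} [NormedAddCommGroup H] [InnerProductSpace ℂ H] [CompleteSpace H]
variable {ι κ : Type*}

/-! ### Pointwise ultraweak sums of completely positive maps -/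

theorem ultraweakHasSum_of_forall_nonneg {T : ι → BOp H →ₗ[ℂ] BOp H} {Θ : BOp H →ₗ[ℂ] BOp H}
    (h : ∀ x, 0 ≤ x → UltraweakHasSum (fun i => T i x) (Θ x)) (x : BOp H) :
    UltraweakHasSum (fun i => T i x) (Θ x) := by
  have hx : x ∈ Submodule.span ℂ {a : BOp H | 0 ≤ a} := by
    rw [CStarAlgebra.span_nonneg]
    trivial
  induction hx using Submodule.span_induction with
  | mem x hx => exact h x hx
  | zero => simpa using ultraweakHasSum_zero
  | add x y _ _ hx hy => simpa using hx.add hy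
  | smul r x _ hx => simpa using hx.smul r

/-- A series of completely positive maps converges pointwise if it does so on the quadratic forms of
positive operators. -/
theorem ultraweakHasSum_of_isCP {T : ι → BOp H →ₗ[ℂ] BOp H} {Θ : BOp H →ₗ[ℂ] BOp H}
    (hT : ∀ i, IsCP (T i))
    (h : ∀ x, 0 ≤ x → ∀ ξ, HasSum (fun i => ⟪ξ, T i x ξ⟫_ℂ) ⟪ξ, Θ x ξ⟫_ℂ) (x : BOp H) :
    UltraweakHasSum (fun i => T i x) (Θ x) :=
  ultraweakHasSum_of_forall_nonneg
    (fun y hy => ultraweakHasSum_of_nonneg (fun i => (hT i).map_nonneg hy) (h y hy)) x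

theorem ultraweakHasSum_of_weakStarSum {T : ℕ → BOp H →ₗ[ℂ] BOp H} {Θ : BOp H →ₗ[ℂ] BOp H}
    (hT : ∀ i, IsCP (T i)) (h : ∀ x, WeakStarSum (fun k => T k x) (Θ x)) (x : BOp H) :
    UltraweakHasSum (fun i => T i x) (Θ x) :=
  ultraweakHasSum_of_isCP hT
    (fun y hy => (h y).hasSum_inner fun i => (hT i).map_nonneg hy) x

theorem ultraweakHasSum_prod {T : ι × κ → BOp H →ₗ[ℂ] BOp H} {S : ι → BOp H →ₗ[ℂ] BOp H}
    {Θ : BOp H →ₗ[ℂ] BOp H} (hT : ∀ p, IsCP (T p))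
    (h : ∀ i x, UltraweakHasSum (fun j => T (i, j) x) (S i x))
    (hS : ∀ x, UltraweakHasSum (fun i => S i x) (Θ x)) (x : BOp H) :
    UltraweakHasSum (fun p => T p x) (Θ x) :=
  ultraweakHasSum_of_isCP hT (fun y hy ξ =>
    hasSum_prod_of_nonneg (fun p => inner_apply_nonneg ((hT p).map_nonneg hy) ξ)
      (fun i => (h i y).inner ξ ξ) ((hS y).inner ξ ξ)) x

/-! ### Kraus decompositions of normal completely positive maps -/

theorem star_Ad_apply (c x : BOp H) : Ad (star c) x = star c * x * c := by
  simp [Ad]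

theorem isNormal_Ad (a : BOp H) : IsNormal (Ad a) := by
  let _ := weakStarTopology H
  refine continuous_iff_continuousAt.2 fun T => ?_
  refine tendsto_weakStar_iff.2 fun ξ η hξ hη => ?_
  have bd : ∀ ζ : ℕ → H, Summable (fun n => ‖ζ n‖ ^ 2) →
      Summable (fun n => ‖star a (ζ n)‖ ^ 2) := fun ζ hζ =>
    Summable.of_nonneg_of_le (fun n => by positivity)
      (fun n => by
        rw [← mul_pow]
        exact pow_le_pow_left₀ (norm_nonneg _) ((star a).le_opNorm (ζ n)) 2)
      (hζ.mul_left (‖star a‖ ^ 2))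
  have := tendsto_weakStar_iff.1 (tendsto_id (x := @nhds (BOp H) (weakStarTopology H) T)) _ _
    (bd ξ hξ) (bd η hη)
  simpa [Ad, ContinuousLinearMap.star_eq_adjoint, ContinuousLinearMap.adjoint_inner_left] using this

theorem inner_star_Ad_apply (c x : BOp H) (ξ η : H) :
    ⟪η, Ad (star c) x ξ⟫_ℂ = ⟪c η, x (c ξ)⟫_ℂ := by
  rw [star_Ad_apply, ContinuousLinearMap.star_eq_adjoint, mul_apply_eq_comp, mul_apply_eq_comp,
    ContinuousLinearMap.adjoint_inner_right]

open InnerProductSpace in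
/-- The operator `y^* y` is the sum of the rank one operators `|y^* eₙ⟩⟨y^* eₙ|`. -/
theorem hasSum_inner_rankOne (b : HilbertBasis ι ℂ H) (y : BOp H) (ξ : H) :
    HasSum (fun n => ⟪ξ, rankOne ℂ (star y (b n)) (star y (b n)) ξ⟫_ℂ) ⟪ξ, (star y * y) ξ⟫_ℂ := by
  simpa [ContinuousLinearMap.star_eq_adjoint, ContinuousLinearMap.adjoint_inner_left,
    ContinuousLinearMap.adjoint_inner_right, inner_smul_right, mul_comm] using
      b.hasSum_inner_mul_inner (y ξ) (y ξ)

/-- Normal completely positive maps on `B(H)` have a Kraus decomposition. Positive operators are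
sums of rank one operators, which extends the decomposition from those by normality. -/
theorem exists_kraus [TopologicalSpace.SeparableSpace H] {Φ : BOp H →ₗ[ℂ] BOp H}
    (hΦ : Φ ∈ NormalCP H) :
    ∃ c : ℕ → BOp H, ∀ x, UltraweakHasSum (fun i => Ad (star (c i)) x) (Φ x) := by
  obtain ⟨ι, c, hc⟩ := hΦ.1.exists_kraus_rankOne
  obtain ⟨d, hd⟩ := exists_nat_reindex (countable_ne_zero_of_summable fun ζ ξ => (hc ζ ξ).summable)
  replace hd : ∀ ζ ξ, HasSum (fun i => ⟪ξ, Ad (star (d i)) (InnerProductSpace.rankOne ℂ ζ ζ) ξ⟫_ℂ)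
      ⟪ξ, Φ (InnerProductSpace.rankOne ℂ ζ ζ) ξ⟫_ℂ := fun ζ ξ => by
    simpa only [star_Ad_apply] using hd
      (fun e => ⟪ξ, (star e * InnerProductSpace.rankOne ℂ ζ ζ * e) ξ⟫_ℂ) (by simp) _ (hc ζ ξ)
  refine ⟨d, ultraweakHasSum_of_isCP (fun i => isCP_Ad _) fun x hx ξ => ?_⟩
  obtain ⟨y, rfl⟩ := CStarAlgebra.nonneg_iff_eq_star_mul_self.1 hx
  obtain ⟨w, b, -⟩ := exists_hilbertBasis ℂ H
  have hpos : ∀ ζ : H, 0 ≤ InnerProductSpace.rankOne ℂ ζ ζ := fun ζ =>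
    (ContinuousLinearMap.nonneg_iff_isPositive _).2 (InnerProductSpace.isPositive_rankOne_self ζ)
  obtain ⟨R, hR0, hR, hRd⟩ : ∃ R : w → BOp H, (∀ n, 0 ≤ R n) ∧
      (∀ ξ, HasSum (fun n => ⟪ξ, R n ξ⟫_ℂ) ⟪ξ, (star y * y) ξ⟫_ℂ) ∧
      ∀ n ξ, HasSum (fun i => ⟪ξ, Ad (star (d i)) (R n) ξ⟫_ℂ) ⟪ξ, Φ (R n) ξ⟫_ℂ :=
    ⟨fun n => InnerProductSpace.rankOne ℂ (star y (b n)) (star y (b n)), fun n => hpos _,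
      hasSum_inner_rankOne b y, fun n => hd _⟩
  have h1 : HasSum (fun p : w × ℕ => ⟪ξ, Ad (star (d p.2)) (R p.1) ξ⟫_ℂ)
      ⟪ξ, Φ (star y * y) ξ⟫_ℂ :=
    hasSum_prod_of_nonneg (fun p => inner_apply_nonneg ((isCP_Ad _).map_nonneg (hR0 p.1)) ξ)
      (fun n => hRd n ξ) (((ultraweakHasSum_of_nonneg hR0 hR).map hΦ.2).inner ξ ξ)
  refine hasSum_prod_fiberwise_snd h1 fun i => ?_
  simp only [inner_star_Ad_apply]
  exact hR (d i ξ)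

/-- If `Φ = ∑ᵢ Ad(cᵢ^*)` is an `S`-bimodule map, then `∑ᵢ (cᵢ a - a cᵢ)^* (cᵢ a - a cᵢ) = 0` for
`a ∈ S`. Hence the `cᵢ` commute with `S`. -/
theorem mem_commutant_of_isBimoduleMap {S : VonNeumannAlgebra H} {Φ : BOp H →ₗ[ℂ] BOp H}
    (hΦ : IsBimoduleMap (S : Set (BOp H)) Φ) {c : ι → BOp H}
    (hc : ∀ x, UltraweakHasSum (fun i => Ad (star (c i)) x) (Φ x)) (i : ι) :
    c i ∈ S.commutant := by
  rw [VonNeumannAlgebra.mem_commutant_iff]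
  intro a ha
  have h1 : (1 : BOp H) ∈ (S : Set (BOp H)) := one_mem S
  have ha' : star a ∈ (S : Set (BOp H)) := star_mem (s := S) ha
  have e1 : Φ a = Φ 1 * a := by simpa using hΦ 1 h1 a ha 1
  have e2 : Φ (star a) = star a * Φ 1 := by simpa using hΦ _ ha' 1 h1 1
  have e3 : Φ (star a * a) = star a * Φ 1 * a := by simpa using hΦ _ ha' a ha 1
  refine ContinuousLinearMap.ext fun ξ => ?_
  have h2 := ((((hc 1).inner (a ξ) (a ξ)).sub ((hc a).inner ξ (a ξ))).sub
    ((hc (star a)).inner (a ξ) ξ)).add ((hc (star a * a)).inner ξ ξ)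
  have h3 : HasSum (fun i => ((‖c i (a ξ) - a (c i ξ)‖ ^ 2 : ℝ) : ℂ)) ((0 : ℝ) : ℂ) := by
    have e4 : ∀ i, ((‖c i (a ξ) - a (c i ξ)‖ ^ 2 : ℝ) : ℂ) =
        ⟪a ξ, Ad (star (c i)) 1 (a ξ)⟫_ℂ - ⟪a ξ, Ad (star (c i)) a ξ⟫_ℂ -
          ⟪ξ, Ad (star (c i)) (star a) (a ξ)⟫_ℂ + ⟪ξ, Ad (star (c i)) (star a * a) ξ⟫_ℂ :=
      fun i => by
        push_cast
        rw [← Complex.coe_algebraMap, ← inner_self_eq_norm_sq_to_K]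
        simp only [inner_star_Ad_apply, one_apply_eq_self, mul_apply_eq_comp]
        simp only [ContinuousLinearMap.star_eq_adjoint, ContinuousLinearMap.adjoint_inner_right,
          inner_sub_left, inner_sub_right]
        ring
    have e5 : ((0 : ℝ) : ℂ) = ⟪a ξ, Φ 1 (a ξ)⟫_ℂ - ⟪a ξ, Φ a ξ⟫_ℂ - ⟪ξ, Φ (star a) (a ξ)⟫_ℂ +
        ⟪ξ, Φ (star a * a) ξ⟫_ℂ := by
      rw [e1, e2, e3]
      simp [ContinuousLinearMap.star_eq_adjoint, ContinuousLinearMap.adjoint_inner_right]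
    simp only [e4]
    rw [e5]
    exact h2
  have h4 := congrFun ((hasSum_zero_iff_of_nonneg fun i => by positivity).1
    (Complex.hasSum_ofReal.1 h3)) i
  have h5 : c i (a ξ) - a (c i ξ) = 0 := by simpa using h4
  exact (sub_eq_zero.1 h5).symm

theorem exists_kraus_commutant [TopologicalSpace.SeparableSpace H] {S : VonNeumannAlgebra H}
    {Φ : BOp H →ₗ[ℂ] BOp H} (hΦ : Φ ∈ NormalCPBimod S) :
    ∃ c : ℕ → BOp H, (∀ i, c i ∈ S.commutant) ∧
      ∀ x, UltraweakHasSum (fun i => Ad (star (c i)) x) (Φ x) := by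
  obtain ⟨c, hc⟩ := exists_kraus hΦ.1
  exact ⟨c, mem_commutant_of_isBimoduleMap hΦ.2 hc, hc⟩

theorem exists_isUnitalKraus [TopologicalSpace.SeparableSpace H] {S : VonNeumannAlgebra H}
    {Φ : BOp H →ₗ[ℂ] BOp H} (hΦ : Φ ∈ NormalUCPBimod S) :
    ∃ c : ℕ → BOp H, IsUnitalKraus S.commutant c Φ := by
  obtain ⟨c, hc, h⟩ := exists_kraus_commutant hΦ.1
  refine ⟨c, hc, ?_, fun x => (h x).weakStarSum⟩
  simpa [star_Ad_apply, hΦ.2] using (h 1).weakStarSum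

/-! ### One-way right LOCC maps -/

theorem IsNormal.comp {E : Type*} [NormedAddCommGroup E] [InnerProductSpace ℂ E]
    {Φ Ψ : BOp E →ₗ[ℂ] BOp E} (hΦ : IsNormal Φ) (hΨ : IsNormal Ψ) :
    IsNormal (Φ.comp Ψ) := by
  unfold IsNormal at *
  rw [LinearMap.coe_comp]
  exact @Continuous.comp _ _ _ (weakStarTopology E) (weakStarTopology E) (weakStarTopology E)
    _ _ hΦ hΨ

theorem NormalCP.comp {Φ Ψ : BOp H →ₗ[ℂ] BOp H} (hΦ : Φ ∈ NormalCP H) (hΨ : Ψ ∈ NormalCP H) :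
    Φ.comp Ψ ∈ NormalCP H :=
  ⟨hΦ.1.comp hΨ.1, hΦ.2.comp hΨ.2⟩

theorem NormalUCPBimod.comp {S : VonNeumannAlgebra H} {Φ Ψ : BOp H →ₗ[ℂ] BOp H}
    (hΦ : Φ ∈ NormalUCPBimod S) (hΨ : Ψ ∈ NormalUCPBimod S) : Φ.comp Ψ ∈ NormalUCPBimod S :=
  ⟨⟨NormalCP.comp hΦ.1.1 hΨ.1.1, fun a ha b hb x => by
    simp only [LinearMap.comp_apply, hΨ.1.2 a ha b hb, hΦ.1.2 a ha b hb]⟩, by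
    simp [hΨ.2, hΦ.2]⟩

theorem Ad_mem_normalCPBimod_commutant {A : VonNeumannAlgebra H} {a : BOp H} (ha : a ∈ A) :
    Ad a ∈ NormalCPBimod A.commutant := by
  refine ⟨⟨isCP_Ad a, isNormal_Ad a⟩, fun b hb c hc x => ?_⟩
  have h1 : a * b = b * a := VonNeumannAlgebra.mem_commutant_iff.1 hb a ha
  have h2 : star a * c = c * star a :=
    VonNeumannAlgebra.mem_commutant_iff.1 hc _ (star_mem ha)
  change a * (b * x * c) * star a = b * (a * x * star a) * c
  calc a * (b * x * c) * star a = (a * b) * x * (c * star a) := by simp only [mul_assoc]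
    _ = b * (a * x * star a) * c := by rw [h1, ← h2]; simp only [mul_assoc]

theorem id_eq_Ad_one : (LinearMap.id : BOp H →ₗ[ℂ] BOp H) = Ad 1 := by
  ext1 x
  simp [Ad]

theorem id_mem_normalUCPBimod (S : VonNeumannAlgebra H) :
    (LinearMap.id : BOp H →ₗ[ℂ] BOp H) ∈ NormalUCPBimod S := by
  refine ⟨⟨?_, fun a _ b _ x => rfl⟩, rfl⟩
  rw [id_eq_Ad_one]
  exact ⟨isCP_Ad 1, isNormal_Ad 1⟩

/-- Together with `exists_ultraweakHasSum_of_mem_LOCCr` this describes `LOCC^r(A)` as the set of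
normal unital completely positive maps `∑ₖ Φₖ ∘ Ad(aₖ^*)` with `aₖ ∈ A` and
`Φₖ ∈ UCP^σ_A(B(H))`. -/
theorem mem_LOCCr_of_ultraweakHasSum {A : VonNeumannAlgebra H} {Θ : BOp H →ₗ[ℂ] BOp H}
    (hΘ : Θ ∈ NormalUCP H) {a : ℕ → BOp H} {Φ : ℕ → BOp H →ₗ[ℂ] BOp H} (ha : ∀ k, a k ∈ A)
    (hΦ : ∀ k, Φ k ∈ NormalUCPBimod A)
    (h : ∀ x, UltraweakHasSum (fun k => Φ k (Ad (star (a k)) x)) (Θ x)) : Θ ∈ LOCCr A := by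
  have hAd := fun k => Ad_mem_normalCPBimod_commutant (star_mem (ha k))
  have hcp := fun k => NormalCP.comp (hΦ k).1.1 (hAd k).1
  exact ⟨fun k => (Φ k).comp (Ad (star (a k))),
    ⟨hcp, fun x => (h x).weakStarSum, hΘ⟩,
    fun k => ⟨hcp k, Φ k, hΦ k, _, hAd k, rfl⟩⟩

theorem exists_ultraweakHasSum_of_mem_LOCCr [TopologicalSpace.SeparableSpace H]
    {A : VonNeumannAlgebra H} {Θ : BOp H →ₗ[ℂ] BOp H} (hΘ : Θ ∈ LOCCr A) :
    ∃ (a : ℕ → BOp H) (Φ : ℕ → BOp H →ₗ[ℂ] BOp H), (∀ k, a k ∈ A) ∧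
      (∀ k, Φ k ∈ NormalUCPBimod A) ∧
      ∀ x, UltraweakHasSum (fun k => Φ k (Ad (star (a k)) x)) (Θ x) := by
  obtain ⟨I, ⟨hI, hsum, -⟩, hloc⟩ := hΘ
  choose _ Φ hΦ Ψ hΨ hcomp using hloc
  choose c hcA hc using fun k => exists_kraus_commutant (hΨ k)
  simp only [VonNeumannAlgebra.commutant_commutant] at hcA
  refine ⟨fun n => c n.unpair.1 n.unpair.2, fun n => Φ n.unpair.1, fun n => hcA _ _,
    fun n => hΦ _, fun x => ?_⟩
  exact (ultraweakHasSum_prod (T := fun p : ℕ × ℕ => (Φ p.1).comp (Ad (star (c p.1 p.2))))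
    (fun p => (hΦ _).1.1.1.comp (isCP_Ad _))
    (fun k y => by
      rw [hcomp k]
      exact (hc k y).map (hΦ k).1.1.2)
    (ultraweakHasSum_of_weakStarSum (fun k => (hI k).1) hsum) x).comp_equiv Nat.pairEquiv.symm

theorem id_mem_LOCCr (A : VonNeumannAlgebra H) :
    (LinearMap.id : BOp H →ₗ[ℂ] BOp H) ∈ LOCCr A := by
  have hid := id_mem_normalUCPBimod A
  refine mem_LOCCr_of_ultraweakHasSum (a := Pi.single 0 1) (Φ := fun _ => LinearMap.id)
    ⟨hid.1.1, hid.2⟩ (fun k => ?_) (fun _ => hid) fun x => ?_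
  · rcases eq_or_ne k 0 with rfl | hk
    · simp
    · simp [Pi.single_eq_of_ne hk]
  · refine ultraweakHasSum_iff.2 fun ξ η hξ hη => ?_
    have := hasSum_single (f := fun i => ∑' n, ⟪η n, Ad (star ((Pi.single 0 1 : ℕ → BOp H) i)) x
      (ξ n)⟫_ℂ) 0 fun k hk => by
      simp only [inner_star_Ad_apply, Pi.single_eq_of_ne hk]
      simp
    simpa [← id_eq_Ad_one] using this

theorem LOCCr.comp [TopologicalSpace.SeparableSpace H] {A : VonNeumannAlgebra H}
    {Θ Θ' : BOp H →ₗ[ℂ] BOp H} (hΘ : Θ ∈ LOCCr A) (hΘ' : Θ' ∈ LOCCr A) :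
    Θ.comp Θ' ∈ LOCCr A := by
  obtain ⟨a, Φ, ha, hΦ, h⟩ := exists_ultraweakHasSum_of_mem_LOCCr hΘ
  obtain ⟨b, Φ', hb, hΦ', h'⟩ := exists_ultraweakHasSum_of_mem_LOCCr hΘ'
  have hu : Θ ∈ NormalUCP H := hΘ.choose_spec.1.2.2
  have hu' : Θ' ∈ NormalUCP H := hΘ'.choose_spec.1.2.2
  -- `Φ'ₗ` commutes with `Ad(aₖ^*)`, which brings the composite into the same form
  have hswap : ∀ k l x, Φ' l (Ad (star (b l * a k)) x) =
      Ad (star (a k)) (Φ' l (Ad (star (b l)) x)) := fun k l x => by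
    rw [star_Ad_apply, star_Ad_apply, star_Ad_apply,
      ← (hΦ' l).1.2 _ (star_mem (s := A) (ha k)) _ (ha k), star_mul]
    simp only [mul_assoc]
  refine mem_LOCCr_of_ultraweakHasSum ⟨NormalCP.comp hu.1 hu'.1, by simp [hu.2, hu'.2]⟩
    (a := fun n => b n.unpair.2 * a n.unpair.1)
    (Φ := fun n => (Φ n.unpair.1).comp (Φ' n.unpair.2))
    (fun n => mul_mem (hb _) (ha _)) (fun n => NormalUCPBimod.comp (hΦ _) (hΦ' _)) fun x => ?_
  exact (ultraweakHasSum_prod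
    (T := fun p : ℕ × ℕ => ((Φ p.1).comp (Φ' p.2)).comp (Ad (star (b p.2 * a p.1))))
    (S := fun k => ((Φ k).comp (Ad (star (a k)))).comp Θ')
    (fun p => ((hΦ _).1.1.1.comp (hΦ' _).1.1.1).comp (isCP_Ad _))
    (fun k y => by
      simp only [LinearMap.comp_apply, hswap]
      exact ((h' y).map (isNormal_Ad _)).map (hΦ k).1.1.2)
    (fun y => h (Θ' y)) x).comp_equiv Nat.pairEquiv.symm

end NormalMaps

end LOCC

theorem mainTheorem5 {H : Type*} [NormedAddCommGroup H] [InnerProductSpace ℂ H]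
    [CompleteSpace H] [TopologicalSpace.SeparableSpace H] (A : VonNeumannAlgebra H) :
    -- (i) closure under finite compositions
    (∀ L : List (LOCC.BOp H →ₗ[ℂ] LOCC.BOp H), (∀ Θ ∈ L, Θ ∈ LOCC.LOCCr A) →
      L.foldr LinearMap.comp LinearMap.id ∈ LOCC.LOCCr A) ∧
    -- (ii) and (iii), simultaneously
    (∀ Θ ∈ LOCC.LOCCr A, ∃ (a : ℕ → LOCC.BOp H) (c : ℕ → ℕ → LOCC.BOp H)
        (Φ : ℕ → LOCC.BOp H →ₗ[ℂ] LOCC.BOp H),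
      (∀ k, a k ∈ A) ∧
      LOCC.WeakStarSum (fun k => star (a k) * a k) 1 ∧
      (∀ k, LOCC.IsUnitalKraus A.commutant (c k) (Φ k)) ∧
      LOCC.IsRightDecomposition A Φ (fun k => LOCC.Ad (star (a k))) Θ) ∧
    -- (iii) for any given decomposition
    (∀ Θ ∈ LOCC.LOCCr A, ∀ Φ Ψ : ℕ → LOCC.BOp H →ₗ[ℂ] LOCC.BOp H,
      LOCC.IsRightDecomposition A Φ Ψ Θ →
      ∃ c : ℕ → ℕ → LOCC.BOp H, ∀ k, LOCC.IsUnitalKraus A.commutant (c k) (Φ k)) := by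
  refine ⟨fun L hL => ?_, fun Θ hΘ => ?_, fun Θ _ Φ Ψ h => ?_⟩
  · induction L with
    | nil => exact LOCC.id_mem_LOCCr A
    | cons Θ L ih =>
      exact LOCC.LOCCr.comp (hL Θ List.mem_cons_self)
        (ih fun Θ' hΘ' => hL Θ' (List.mem_cons_of_mem Θ hΘ'))
  · obtain ⟨a, Φ, ha, hΦ, h⟩ := LOCC.exists_ultraweakHasSum_of_mem_LOCCr hΘ
    choose c hc using fun k => LOCC.exists_isUnitalKraus (hΦ k)
    have hΘ1 : Θ 1 = 1 := hΘ.choose_spec.1.2.2.2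
    have e : ∀ k, Φ k (LOCC.Ad (star (a k)) 1) = star (a k) * a k := fun k => by
      rw [LOCC.star_Ad_apply, (hΦ k).1.2 _ (star_mem (s := A) (ha k)) _ (ha k), (hΦ k).2, mul_one]
    refine ⟨a, c, Φ, ha, ?_, hc, hΦ,
      fun k => LOCC.Ad_mem_normalCPBimod_commutant (star_mem (ha k)),
      fun x => (h x).weakStarSum⟩
    simpa only [e, hΘ1] using (h 1).weakStarSum
  · choose c hc using fun k => LOCC.exists_isUnitalKraus (h.1 k)
    exact ⟨c, hc⟩
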